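/- A car park has $n$ spaces in a line, numbered $1,\dots,n$. Drivers arrive one after another, each with a preferred space; a driver parks in the preferred space if it is free, otherwise in the first free space with a larger number, and leaves without parking if there is none. Let $\mathrm{cp}(n,m,k)$ be the number of maps $\{1,\dots,m\}\to\{1,\dots,n\}$ (the choices of $m$ drivers) for which exactly $k$ drivers fail to park (so it is $0$ if $k<0$). Let $T(v)=\sum_{i\ge 1}\frac{i^{i-1}}{i!}v^i$ be the tree function. Theorem. Let $\lambda>0$ be real. If $\lfloor\lambda n\rfloor$ drivers choose their preferred spaces among the $n$ spaces independently and uniformly at random, then the probability that all $n$ spaces are occupied in the end, which equals $\mathrm{cp}(n,\lfloor\lambda n\rfloor,\lfloor\lambda n\rfloor-n)/n^{\lfloor\lambda n\rfloor}$, converges as $n\to\infty$, and $$\lim_{n\to\infty}\frac{\mathrm{cp}(n,\lfloor\lambda n\rfloor,\lfloor\lambda n\rfloor-n)}{n^{\lfloor\lambda n\rfloor}}=\begin{cases}0&\text{if }\lambda\le 1,\\ 1-\frac1\lambda\,T(\lambda e^{-\lambda})&\text{if }\lambda>1,\end{cases}$$ where the series $T(\lambda e^{-\lambda})$ converges for $\lambda>1$.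 -/

import Mathlib

open Filter Topology

namespace CarPark

/-- The free spaces numbered at least `p`, when `S` is the set of occupied spaces. -/
def freeFrom {n : ℕ} (S : Finset (Fin n)) (p : Fin n) : Finset (Fin n) :=
  Finset.univ.filter fun s => p ≤ s ∧ s ∉ S

/-- Arrival of one driver with preferred space `p`. The state is the set of occupied spaces
together with the number of drivers who have left so far. The driver takes the first free space
with number at least `p`; if there is none, the driver leaves. -/
def arrive {n : ℕ} (x : Finset (Fin n) × ℕ) (p : Fin n) : Finset (Fin n) × ℕ :=
  if h : (freeFrom x.1 p).Nonempty then (insert ((freeFrom x.1 p).min' h) x.1, x.2)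
  else (x.1, x.2 + 1)

/-- The state after drivers `0, …, m - 1` have arrived in this order at the empty car park with
`n` spaces, driver `j` preferring space `c j`. -/
def finalState {n m : ℕ} (c : Fin m → Fin n) : Finset (Fin n) × ℕ :=
  (List.ofFn c).foldl arrive (∅, 0)

/-- The set of spaces occupied in the end. -/
def occupied {n m : ℕ} (c : Fin m → Fin n) : Finset (Fin n) := (finalState c).1

/-- The number of drivers who fail to park. -/
def defect {n m : ℕ} (c : Fin m → Fin n) : ℕ := (finalState c).2

/-- The car parking number: the number of assignments of `m` drivers to `n` spaces for which
exactly `k` drivers fail to park (it is `0` for negative `k`). -/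
def cp (n m : ℕ) (k : ℤ) : ℕ :=
  (Finset.univ.filter fun c : Fin m → Fin n => (defect c : ℤ) = k).card

/-- The probability that all `n` spaces are occupied in the end, when the choices of the `m`
drivers are independent and uniform, that is, all `n ^ m` assignments are equally likely. -/
noncomputable def fullProb (n m : ℕ) : ℝ :=
  ((Finset.univ.filter fun c : Fin m → Fin n => occupied c = Finset.univ).card : ℝ) / (n : ℝ) ^ m

/-- The term `i ^ (i - 1) / i! * v ^ i` of the tree function, for `i = j + 1`. -/
noncomputable def treeTerm (v : ℝ) (j : ℕ) : ℝ :=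
  ((j : ℝ) + 1) ^ j / ((j + 1).factorial : ℝ) * v ^ (j + 1)

/-- The tree function `T(v) = ∑_{i ≥ 1} i ^ (i - 1) / i! * v ^ i`. -/
noncomputable def treeFun (v : ℝ) : ℝ := ∑' j : ℕ, treeTerm v j

end CarPark

namespace CarPark

/-! All spaces fill exactly when, for each `k ≤ n`, at least `k` drivers prefer the first `k` spaces
(`occupied_eq_univ_iff`). If this fails first at `k = j + 1`, then exactly `j` drivers prefer the
first `j` spaces, they fill them, nobody prefers the next space, and the other `m - j` drivers
choose freely beyond it. Summing over `j` gives `pow_eq_fullCount_add_sum`. With `n` drivers on `n +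
1` spaces this recursion, compared with Abel's identity `abelSum_eq_pow`, yields `fullCount_self`.

For `m ≥ n` the probability of not filling is therefore a sum over `j < n` of binomial probabilities
divided by `j + 1`. For `lam > 1` each term has a Poisson limit (`tendsto_failureProb`), which is a
tree function term over `lam`; the Chernoff bound `failureProb_le` is geometric in `j` and uniform
in `n`, so dominated convergence applies. For `lam < 1` there are too few drivers, and `lam = 1`
follows from the exact count. -/

/-- Every initial segment of `k ≤ n` spaces is preferred by at least `k` drivers. -/
def PrefixFull {ι : Type*} [Fintype ι] {n : ℕ} (c : ι → Fin n) : Prop :=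
  ∀ k ≤ n, k ≤ (Finset.univ.filter fun i => (c i : ℕ) < k).card

instance {ι : Type*} [Fintype ι] {n : ℕ} (c : ι → Fin n) : Decidable (PrefixFull c) :=
  inferInstanceAs (Decidable (∀ k ≤ n, k ≤ (Finset.univ.filter fun i => (c i : ℕ) < k).card))

/-! ### The parking process and the prefix criterion. -/

lemma mem_freeFrom {n : ℕ} {S : Finset (Fin n)} {p s : Fin n} :
    s ∈ freeFrom S p ↔ p ≤ s ∧ s ∉ S := by
  simp [freeFrom]

lemma arrive_cases {n : ℕ} (x : Finset (Fin n) × ℕ) (p : Fin n) :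
    (∃ t, p ≤ t ∧ t ∉ x.1 ∧ (∀ s, p ≤ s → s ∉ x.1 → t ≤ s) ∧ arrive x p = (insert t x.1, x.2)) ∨
    ((∀ s, p ≤ s → s ∈ x.1) ∧ arrive x p = (x.1, x.2 + 1)) := by
  by_cases h : (freeFrom x.1 p).Nonempty
  · left
    have hm := mem_freeFrom.1 (Finset.min'_mem _ h)
    refine ⟨(freeFrom x.1 p).min' h, hm.1, hm.2, fun s h1 h2 => ?_, by simp [arrive, h]⟩
    exact Finset.min'_le _ _ (mem_freeFrom.2 ⟨h1, h2⟩)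
  · right
    refine ⟨fun s hs => ?_, by simp [arrive, h]⟩
    by_contra h2
    exact h ⟨s, mem_freeFrom.2 ⟨hs, h2⟩⟩

lemma card_add_defect_foldl {n : ℕ} (l : List (Fin n)) :
    ((l.foldl arrive (∅, 0)).1.card) + (l.foldl arrive (∅, 0)).2 = l.length := by
  induction l using List.reverseRecOn with
  | nil => simp
  | append_singleton l p ih =>
    rw [List.foldl_append, List.foldl_cons, List.foldl_nil, List.length_append]
    rcases arrive_cases (l.foldl arrive (∅, 0)) p with ⟨t, -, ht, -, h⟩ | ⟨-, h⟩
    · rw [h]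
      simp only [Finset.card_insert_of_notMem ht, List.length_singleton]
      omega
    · rw [h]
      simp only [List.length_singleton]
      omega

/-- Drivers only move forward, so each occupied space below `k` is taken by a driver whose
preference is below `k`. -/
lemma card_prefix_le_countP {n : ℕ} (l : List (Fin n)) (k : ℕ) :
    ((l.foldl arrive (∅, 0)).1.filter fun s : Fin n => (s : ℕ) < k).card
      ≤ l.countP fun p : Fin n => (p : ℕ) < k := by
  induction l using List.reverseRecOn with
  | nil => simp
  | append_singleton l p ih =>
    rw [List.foldl_append, List.foldl_cons, List.foldl_nil, List.countP_append]
    rcases arrive_cases (l.foldl arrive (∅, 0)) p with ⟨t, hp, ht, -, h⟩ | ⟨-, h⟩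
    · rw [h]
      simp only [Finset.filter_insert, List.countP_singleton]
      have hp' : (p : ℕ) ≤ t := hp
      split_ifs with h1 h2 h2
      · exact (Finset.card_insert_le _ _).trans (by omega)
      · simp at h2; omega
      · omega
      · omega
    · rw [h]
      exact ih.trans (Nat.le_add_right _ _)

/-- A space free in the end was free throughout, so nobody drove past it: every driver preferring
`s` or an earlier space parked strictly before `s`. -/
lemma countP_le_card_of_free {n : ℕ} (l : List (Fin n)) (s : Fin n)
    (hs : s ∉ (l.foldl arrive (∅, 0)).1) :
    (l.countP fun p : Fin n => (p : ℕ) < s + 1)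
      ≤ ((l.foldl arrive (∅, 0)).1.filter fun t : Fin n => (t : ℕ) < s).card := by
  induction l using List.reverseRecOn with
  | nil => simp
  | append_singleton l p ih =>
    rw [List.foldl_append, List.foldl_cons, List.foldl_nil] at hs ⊢
    rw [List.countP_append]
    rcases arrive_cases (l.foldl arrive (∅, 0)) p with ⟨t, hp, ht, hmin, h⟩ | ⟨hall, h⟩
    · rw [h] at hs ⊢
      simp only [Finset.mem_insert, not_or] at hs
      have := ih hs.2
      simp only [Finset.filter_insert, List.countP_singleton]
      by_cases hps : p ≤ s
      · have hlt : t < s := lt_of_le_of_ne (hmin s hps hs.2) (Ne.symm hs.1)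
        have hlt' : (t : ℕ) < s := hlt
        rw [if_pos hlt', Finset.card_insert_of_notMem (by simp [ht])]
        split_ifs <;> omega
      · have hps' : ¬ ((p : ℕ) < s + 1) := fun hh => hps (Fin.le_def.2 (by omega))
        have hp' : (p : ℕ) ≤ t := hp
        rw [if_neg (by omega : ¬ (t : ℕ) < s)]
        simpa [hps] using this
    · rw [h] at hs ⊢
      have hps : ¬ p ≤ s := fun hh => hs (hall s hh)
      have hps' : ¬ ((p : ℕ) < s + 1) := fun hh => hps (Fin.le_def.2 (by omega))
      have := ih hs
      simpa [List.countP_singleton, hps] using this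

lemma countP_ofFn_eq_card {n m : ℕ} (c : Fin m → Fin n) (k : ℕ) :
    ((List.ofFn c).countP fun p : Fin n => (p : ℕ) < k)
      = (Finset.univ.filter fun i => (c i : ℕ) < k).card := by
  induction m with
  | zero => simp
  | succ m ih =>
    rw [List.ofFn_succ, List.countP_cons, ih, Fin.card_filter_univ_succ]
    split_ifs <;> simp_all

lemma card_fin_lt {n k : ℕ} (hk : k ≤ n) :
    (Finset.univ.filter fun s : Fin n => (s : ℕ) < k).card = k := by
  rw [Fin.card_filter_val_lt, min_eq_right hk]

lemma occupied_eq_univ_iff {n m : ℕ} (c : Fin m → Fin n) :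
    occupied c = Finset.univ ↔ PrefixFull c := by
  constructor
  · intro h k hk
    have := card_prefix_le_countP (List.ofFn c) k
    rw [countP_ofFn_eq_card] at this
    change ((occupied c).filter fun s : Fin n => (s : ℕ) < k).card ≤ _ at this
    rwa [h, card_fin_lt hk] at this
  · intro h
    by_contra hne
    obtain ⟨s, hs⟩ : ∃ s, s ∉ occupied c := by
      by_contra! hall
      exact hne (Finset.eq_univ_iff_forall.2 hall)
    have h1 := countP_le_card_of_free (List.ofFn c) s hs
    rw [countP_ofFn_eq_card] at h1
    have h2 := h (s + 1) s.2
    have h3 : ((occupied c).filter fun t : Fin n => (t : ℕ) < s).card ≤ s :=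
      (Finset.card_le_card (Finset.filter_subset_filter _ (Finset.subset_univ _))).trans
        (card_fin_lt s.2.le).le
    exact absurd (h2.trans (h1.trans h3)) (by omega)

lemma occupied_eq_univ_iff_defect {n m : ℕ} (c : Fin m → Fin n) :
    occupied c = Finset.univ ↔ (defect c : ℤ) = (m : ℤ) - n := by
  have h : (occupied c).card + defect c = m := by
    simpa [occupied, defect, finalState] using card_add_defect_foldl (List.ofFn c)
  rw [← Finset.card_eq_iff_eq_univ, Fintype.card_fin]
  omega

/-! ### Decomposition by the first deficient prefix. -/

/-- The number of choices of `m` drivers that fill all `n` spaces. -/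
def fullCount (n m : ℕ) : ℕ := (Finset.univ.filter fun c : Fin m → Fin n => PrefixFull c).card

/-- The choices for which the first `j + 1` spaces form the shortest initial segment that is not
preferred by enough drivers. -/
def firstFailure (n m j : ℕ) : Finset (Fin m → Fin n) :=
  Finset.univ.filter fun c => (∀ k ≤ j, k ≤ (Finset.univ.filter fun i => (c i : ℕ) < k).card) ∧
    (Finset.univ.filter fun i => (c i : ℕ) < j + 1).card < j + 1

lemma card_prefix_glue {n m j : ℕ} (hj : j ≤ n) (S : Finset (Fin m)) (e : S ≃ Fin j)
    (d : Fin j → Fin j) (c : Fin m → Fin n)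
    (h1 : ∀ i (h : i ∈ S), c i = Fin.castLE hj (d (e ⟨i, h⟩)))
    (h2 : ∀ i ∉ S, j < (c i : ℕ)) {k : ℕ} (hk : k ≤ j) :
    (Finset.univ.filter fun i => (c i : ℕ) < k).card
      = (Finset.univ.filter fun x => (d x : ℕ) < k).card := by
  symm
  refine Finset.card_nbij (fun x => (e.symm x : Fin m)) ?_ ?_ ?_
  · intro x hx
    simp only [Finset.mem_univ, true_and, Finset.coe_filter, Set.mem_ofPred_eq] at hx ⊢
    rw [h1 _ (e.symm x).2]
    simpa using hx
  · intro x _ y _ hxy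
    exact e.symm.injective (Subtype.ext hxy)
  · intro i hi
    simp only [Finset.coe_filter, Finset.mem_univ, true_and, Set.mem_ofPred_eq] at hi
    have hS : i ∈ S := by
      by_contra h
      have := h2 i h
      omega
    refine ⟨e ⟨i, hS⟩, ?_, by simp⟩
    rw [h1 i hS] at hi
    simpa using hi

/-- The `j` drivers in `S` all prefer the first `j` spaces, because that prefix already has `j` of
them. So `c` is the gluing of a prefix-full map on `S` and an arbitrary map from the complement into
the `n - 1 - j` spaces beyond index `j`. -/
lemma card_firstFailure_fiber {n m j : ℕ} (hj : j < n) (S : Finset (Fin m)) (hS : S.card = j) :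
    ((firstFailure n m j).filter
        fun c => (Finset.univ.filter fun i => (c i : ℕ) < j + 1) = S).card
      = fullCount j j * (n - 1 - j) ^ (m - j) := by
  classical
  have hB : Fintype.card ({i // i ∉ S} → {x : Fin n // j < (x : ℕ)}) = (n - 1 - j) ^ (m - j) := by
    rw [Fintype.card_fun]
    congr 1
    · have : Fintype.card {x : Fin n // j < (x : ℕ)} = (Finset.Ioi (⟨j, hj⟩ : Fin n)).card :=
        Fintype.card_of_subtype _ (by simp [Fin.lt_def])
      rw [this, Fin.card_Ioi]
    · rw [Fintype.card_subtype_compl]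
      simp [hS]
  let e : S ≃ Fin j := S.equivFinOfCardEq hS
  rw [← hB, fullCount, ← Finset.card_univ, ← Finset.card_product]
  symm
  let Φ : (Fin j → Fin j) × ({i // i ∉ S} → {x : Fin n // j < (x : ℕ)}) → Fin m → Fin n :=
    fun p i => if h : i ∈ S then Fin.castLE hj.le (p.1 (e ⟨i, h⟩)) else (p.2 ⟨i, h⟩).1
  have hΦ1 : ∀ p i (h : i ∈ S), Φ p i = Fin.castLE hj.le (p.1 (e ⟨i, h⟩)) :=
    fun p i h => by simp [Φ, h]
  have hΦ2 : ∀ p i (h : i ∉ S), Φ p i = (p.2 ⟨i, h⟩).1 := fun p i h => by simp [Φ, h]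
  refine Finset.card_nbij Φ ?_ ?_ ?_
  · rintro p hp
    have hp1 : PrefixFull p.1 := by simpa using hp
    have hfil : (Finset.univ.filter fun i => (Φ p i : ℕ) < j + 1) = S := by
      ext i
      simp only [Finset.mem_filter, Finset.mem_univ, true_and]
      by_cases h : i ∈ S
      · simp only [hΦ1 p i h, h, iff_true, Fin.val_castLE]
        have := (p.1 (e ⟨i, h⟩)).2
        omega
      · simp only [hΦ2 p i h, h, iff_false]
        have := (p.2 ⟨i, h⟩).2
        omega
    simp only [firstFailure, Finset.mem_filter, Finset.mem_univ, true_and, Finset.coe_filter,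
      Set.mem_ofPred_eq]
    refine ⟨⟨fun k hk => ?_, by rw [hfil]; omega⟩, hfil⟩
    rw [card_prefix_glue hj.le S e p.1 (Φ p) (hΦ1 p)
      (fun i h => by rw [hΦ2 p i h]; exact (p.2 ⟨i, h⟩).2) hk]
    exact hp1 k hk
  · rintro p - q - hpq
    refine Prod.ext (funext fun x => ?_) (funext fun y => ?_)
    · have := congrFun hpq (e.symm x)
      rw [hΦ1 p _ (e.symm x).2, hΦ1 q _ (e.symm x).2] at this
      simpa using this
    · have := congrFun hpq y
      rw [hΦ2 p _ y.2, hΦ2 q _ y.2] at this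
      exact Subtype.ext this
  · intro c hc
    simp only [firstFailure, Finset.mem_filter, Finset.mem_univ, true_and, Finset.coe_filter,
      Set.mem_ofPred_eq] at hc
    obtain ⟨⟨hc1, -⟩, hc3⟩ := hc
    have hsub : (Finset.univ.filter fun i => (c i : ℕ) < j) = S := by
      refine Finset.eq_of_subset_of_card_le ?_ (by rw [hS]; exact hc1 j le_rfl)
      rw [← hc3]
      intro i hi
      simp only [Finset.mem_filter, Finset.mem_univ, true_and] at hi ⊢
      omega
    have hin : ∀ i ∈ S, (c i : ℕ) < j := fun i hi => by
      rw [← hsub] at hi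
      simpa using hi
    have hout : ∀ i ∉ S, j < (c i : ℕ) := fun i hi => by
      rw [← hc3] at hi
      simp only [Finset.mem_filter, Finset.mem_univ, true_and] at hi
      omega
    let d : Fin j → Fin j := fun x => ⟨c (e.symm x), hin _ (e.symm x).2⟩
    have hd : ∀ i (h : i ∈ S), c i = Fin.castLE hj.le (d (e ⟨i, h⟩)) := fun i h => by
      ext
      simp [d]
    refine ⟨(d, fun y => ⟨c y, hout _ y.2⟩), ?_, ?_⟩
    · simp only [Finset.coe_product, Finset.coe_univ, Set.mem_prod, Set.mem_univ, and_true,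
        Finset.coe_filter, Finset.mem_univ, true_and, Set.mem_ofPred_eq]
      intro k hk
      rw [← card_prefix_glue hj.le S e d c hd hout hk]
      exact hc1 k hk
    · funext i
      by_cases h : i ∈ S
      · rw [hΦ1 _ i h, ← hd i h]
      · rw [hΦ2 _ i h]

lemma card_firstFailure {n m j : ℕ} (hj : j < n) :
    (firstFailure n m j).card = m.choose j * (fullCount j j * (n - 1 - j) ^ (m - j)) := by
  classical
  rw [Finset.card_eq_sum_card_fiberwise (t := Finset.powersetCard j Finset.univ)
    (f := fun c => Finset.univ.filter fun i => (c i : ℕ) < j + 1)]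
  · rw [Finset.sum_congr rfl fun S hS =>
      card_firstFailure_fiber hj S (Finset.mem_powersetCard.1 hS).2]
    simp
  · intro c hc
    simp only [firstFailure, Finset.mem_univ, true_and, Finset.coe_filter,
      Set.mem_ofPred_eq] at hc
    simp only [Finset.mem_coe, Finset.mem_powersetCard,
      Finset.subset_univ, true_and]
    refine le_antisymm (by omega) ((hc.1 j le_rfl).trans (Finset.card_le_card ?_))
    intro i hi
    simp only [Finset.mem_filter, Finset.mem_univ, true_and] at hi ⊢
    omega

lemma filter_not_prefixFull_eq_biUnion (n m : ℕ) :
    (Finset.univ.filter fun c : Fin m → Fin n => ¬ PrefixFull c)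
      = (Finset.range n).biUnion (firstFailure n m) := by
  ext c
  simp only [Finset.mem_filter, Finset.mem_univ, true_and, Finset.mem_biUnion, Finset.mem_range,
    firstFailure]
  constructor
  · intro h
    have h' : ∃ k, k ≤ n ∧ (Finset.univ.filter fun i => (c i : ℕ) < k).card < k := by
      simpa [PrefixFull] using h
    classical
    obtain ⟨hn, hlt⟩ := Nat.find_spec h'
    have hmin := fun k => Nat.find_min (m := k) h'
    -- The least deficient length is not `0`, since no cardinality is below `0`.
    rcases hk : Nat.find h' with _ | j
    · rw [hk] at hlt
      omega
    · rw [hk] at hn hlt hmin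
      refine ⟨j, hn, fun k hkj => ?_, hlt⟩
      have := hmin k (by omega)
      by_contra h2
      exact this ⟨by omega, by omega⟩
  · rintro ⟨j, hj, -, h2⟩ h
    have := h (j + 1) hj
    omega

lemma pow_eq_fullCount_add_sum (n m : ℕ) :
    n ^ m = fullCount n m
      + ∑ j ∈ Finset.range n, m.choose j * (fullCount j j * (n - 1 - j) ^ (m - j)) := by
  classical
  have h := Finset.card_filter_add_card_filter_not (s := (Finset.univ : Finset (Fin m → Fin n)))
    (fun c => PrefixFull c)
  rw [filter_not_prefixFull_eq_biUnion, Finset.card_biUnion, Finset.card_univ, Fintype.card_fun,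
    Fintype.card_fin, Fintype.card_fin] at h
  · rw [← h, fullCount]
    congr 1
    exact Finset.sum_congr rfl fun j hj => card_firstFailure (Finset.mem_range.1 hj)
  · have key : ∀ i j : ℕ, i < j → Disjoint (firstFailure n m i) (firstFailure n m j) := by
      intro i j hij
      rw [Finset.disjoint_left]
      intro c hi hj
      simp only [firstFailure, Finset.mem_filter, Finset.mem_univ, true_and] at hi hj
      have := hj.1 (i + 1) hij
      omega
    intro i _ j _ hij
    rcases lt_or_gt_of_ne hij with h | h
    · exact key i j h
    · exact (key j i h).symm

lemma fullCount_eq_zero_of_lt {n m : ℕ} (h : m < n) : fullCount n m = 0 := by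
  rw [fullCount, Finset.card_eq_zero, Finset.filter_eq_empty_iff]
  intro c _ hc
  have h1 := hc n le_rfl
  have h2 := Finset.card_le_univ (Finset.univ.filter fun i => (c i : ℕ) < n)
  rw [Fintype.card_fin] at h2
  omega

/-! ### Abel's identity and the number of parking functions. -/

lemma alternating_sum_choose_mul_pow (m : ℕ) :
    ∑ j ∈ Finset.range (m + 2), ((m + 1).choose j : ℝ) * ((j : ℝ) + 1) ^ m * (-1) ^ (m + 1 - j)
      = 0 := by
  -- The finite difference of order `m + 1` kills `x ^ m`; it is evaluated at `1`.
  have h := congrFun (fwdDiff_iter_pow_eq_zero_of_lt (R := ℝ) (Nat.lt_succ_self m)) 1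
  rw [fwdDiff_iter_eq_sum_shift, Pi.zero_apply] at h
  refine Eq.trans ?_ h
  refine Finset.sum_congr rfl fun j _ => ?_
  simp
  ring

/-- The Abel-type sum `∑ C(m, j) (j + 1) ^ (j - 1) (x - (j + 1)) ^ (m - j)`. -/
noncomputable def abelSum (m : ℕ) (x : ℝ) : ℝ :=
  ∑ j ∈ Finset.range (m + 1),
    (m.choose j : ℝ) * (((j : ℝ) + 1) ^ j / (j + 1)) * (x - (j + 1)) ^ (m - j)

/-- At `x = 0` the powers of `j + 1` in each term combine to `(j + 1) ^ m`, leaving a finite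
difference of order `m + 1`. -/
lemma abelSum_succ_zero (m : ℕ) : abelSum (m + 1) 0 = 0 := by
  refine Eq.trans ?_ (alternating_sum_choose_mul_pow m)
  rw [abelSum]
  refine Finset.sum_congr rfl fun j hj => ?_
  have hj' : j ≤ m + 1 := Nat.lt_succ_iff.1 (Finset.mem_range.1 hj)
  have hpos : (j : ℝ) + 1 ≠ 0 := by positivity
  have h1 : ((j : ℝ) + 1) ^ j * (j + 1) ^ (m + 1 - j) = (j + 1) ^ m * (j + 1) := by
    rw [← pow_add, ← pow_succ, Nat.add_sub_cancel' hj']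
  rw [zero_sub, neg_pow, mul_assoc, mul_assoc]
  congr 1
  field_simp
  linear_combination h1

lemma hasDerivAt_abelSum (m : ℕ) (x : ℝ) :
    HasDerivAt (abelSum (m + 1)) ((m + 1) * abelSum m x) x := by
  have h : HasDerivAt (abelSum (m + 1)) (∑ j ∈ Finset.range (m + 2),
      ((m + 1).choose j : ℝ) * (((j : ℝ) + 1) ^ j / (j + 1)) *
        (((m + 1 - j : ℕ) : ℝ) * (x - (j + 1)) ^ (m + 1 - j - 1) * 1)) x := by
    unfold abelSum
    refine HasDerivAt.fun_sum fun j _ => ?_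
    exact (((hasDerivAt_id x).sub_const _).pow _).const_mul _
  convert h using 1
  rw [Finset.sum_range_succ, abelSum, Finset.mul_sum]
  simp only [Nat.sub_self, Nat.cast_zero, zero_mul, mul_zero, add_zero, mul_one]
  refine Finset.sum_congr rfl fun j hj => ?_
  have hj' : j ≤ m := Nat.lt_succ_iff.1 (Finset.mem_range.1 hj)
  have hc : ((m : ℝ) + 1) * (m.choose j : ℝ)
      = ((m + 1).choose j : ℝ) * ((m + 1 - j : ℕ) : ℝ) := by
    have h3 := Nat.choose_mul_succ_eq m j
    exact_mod_cast (by rw [mul_comm]; exact h3)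
  rw [show m + 1 - j - 1 = m - j by omega]
  linear_combination (((j : ℝ) + 1) ^ j / (j + 1)) * (x - (j + 1)) ^ (m - j) * hc

/-- Both sides satisfy the Appell relation (the derivative at `m + 1` is `m + 1` times the function
at `m`) and vanish at `0` for positive index. -/
lemma abelSum_eq_pow (m : ℕ) (x : ℝ) : abelSum m x = x ^ m := by
  induction m generalizing x with
  | zero => simp [abelSum]
  | succ m ih =>
    have hd : ∀ y, HasDerivAt (fun y => abelSum (m + 1) y - y ^ (m + 1)) 0 y := fun y => by
      have := (hasDerivAt_abelSum m y).fun_sub (hasDerivAt_pow (m + 1) y)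
      rw [ih] at this
      simpa using this
    have := is_const_of_deriv_eq_zero (fun y => (hd y).differentiableAt) (fun y => (hd y).deriv) x 0
    simp only [abelSum_succ_zero] at this
    simp at this
    linarith

/-- The number of parking functions of length `n` is `(n + 1) ^ (n - 1)`. -/
lemma fullCount_self (n : ℕ) : (fullCount n n : ℝ) = ((n : ℝ) + 1) ^ n / (n + 1) := by
  induction n using Nat.strong_induction_on with
  | _ n ih =>
    -- With `n` drivers on `n + 1` spaces the full count is `0`, and the term `j = n` is `fullCount
    -- n n` times `0 ^ 0 = 1`. Abel's identity at `x = n + 1` has the same total and, by induction,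
    -- the same terms for `j < n`, so the last terms agree.
    have h := pow_eq_fullCount_add_sum (n + 1) n
    rw [fullCount_eq_zero_of_lt (Nat.lt_succ_self n), zero_add, Finset.sum_range_succ] at h
    have h2 := abelSum_eq_pow n ((n : ℝ) + 1)
    rw [abelSum, Finset.sum_range_succ] at h2
    have h' := congrArg (Nat.cast : ℕ → ℝ) h
    push_cast at h'
    rw [← h2] at h'
    have hsum : ∑ j ∈ Finset.range n, (n.choose j : ℝ) * (((j : ℝ) + 1) ^ j / (j + 1)) *
          ((n : ℝ) + 1 - (j + 1)) ^ (n - j)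
        = ∑ j ∈ Finset.range n, (n.choose j : ℝ) * ((fullCount j j : ℝ) *
          ((n + 1 - 1 - j : ℕ) : ℝ) ^ (n - j)) := by
      refine Finset.sum_congr rfl fun j hj => ?_
      have hj' := Finset.mem_range.1 hj
      rw [ih j hj', Nat.add_sub_cancel, Nat.cast_sub hj'.le, mul_assoc]
      congr 3
      ring
    rw [hsum] at h'
    simpa using h'.symm

/-! ### Failure probabilities and their limits. -/

/-- The probability that a binomial variable with parameters `m` and `(j + 1) / n` equals `j`,
divided by `j + 1`: the probability that the first `j + 1` spaces form the shortest initial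
segment that is not preferred by enough drivers. -/
noncomputable def failureProb (n m j : ℕ) : ℝ :=
  (m.choose j : ℝ) * (((j : ℝ) + 1) / n) ^ j * (1 - ((j : ℝ) + 1) / n) ^ (m - j) / (j + 1)

lemma fullProb_eq_fullCount_div (n m : ℕ) : fullProb n m = fullCount n m / (n : ℝ) ^ m := by
  rw [fullProb, fullCount]
  simp only [occupied_eq_univ_iff]

lemma fullProb_eq_cp_div (n m : ℕ) :
    fullProb n m = (cp n m ((m : ℤ) - (n : ℤ)) : ℝ) / (n : ℝ) ^ m := by
  rw [fullProb, cp]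
  simp only [occupied_eq_univ_iff_defect]

lemma fullProb_eq_one_sub_sum {n m : ℕ} (hn : 0 < n) (hnm : n ≤ m) :
    fullProb n m = 1 - ∑ j ∈ Finset.range n, failureProb n m j := by
  have h := congrArg (Nat.cast : ℕ → ℝ) (pow_eq_fullCount_add_sum n m)
  push_cast at h
  have hn' : (n : ℝ) ≠ 0 := by positivity
  have hpow : (n : ℝ) ^ m ≠ 0 := pow_ne_zero _ hn'
  rw [fullProb_eq_fullCount_div, eq_sub_iff_add_eq, ← div_self hpow]
  nth_rw 2 [h]
  rw [add_div, Finset.sum_div]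
  congr 1
  refine Finset.sum_congr rfl fun j hj => ?_
  have hj' := Finset.mem_range.1 hj
  have h1 : ((n - 1 - j : ℕ) : ℝ) = n - (j + 1) := by
    rw [show n - 1 - j = n - (j + 1) by omega, Nat.cast_sub hj']
    push_cast
    ring
  have h2 : 1 - ((j : ℝ) + 1) / n = (n - (j + 1)) / n := by field_simp
  rw [failureProb, fullCount_self, h1, h2, div_pow, div_pow,
    ← Nat.add_sub_cancel' (hj'.le.trans hnm), pow_add, Nat.add_sub_cancel_left]
  field_simp

lemma failureProb_nonneg {n m j : ℕ} (hj : j < n) : 0 ≤ failureProb n m j := by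
  have hn : (0 : ℝ) < n := by exact_mod_cast (Nat.zero_le j).trans_lt hj
  have h1 : ((j : ℝ) + 1) / n ≤ 1 := (div_le_one hn).2 (by exact_mod_cast hj)
  have h2 : (0 : ℝ) ≤ 1 - ((j : ℝ) + 1) / n := by linarith
  unfold failureProb
  positivity

/-- A Chernoff bound for `failureProb`. -/
lemma failureProb_le {n m j : ℕ} {μ : ℝ} (hμ : 1 < μ) (hj : j < n) (hm : μ * n ≤ m) :
    failureProb n m j ≤ Real.exp (1 - μ) * (μ * Real.exp (1 - μ)) ^ j := by
  have hn : (0 : ℝ) < n := by exact_mod_cast (Nat.zero_le j).trans_lt hj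
  have hμ0 : 0 < μ := by linarith
  have hnm : n ≤ m := by
    have : (n : ℝ) ≤ m := by nlinarith
    exact_mod_cast this
  set a : ℝ := ((j : ℝ) + 1) / n with ha
  have ha0 : 0 ≤ a := by positivity
  have ha1 : a ≤ 1 := (div_le_one hn).2 (by exact_mod_cast hj)
  have hb : 0 ≤ 1 - a := by linarith
  -- One term of the binomial generating function at `μ⁻¹`, the value at which the resulting bound
  -- is geometric with ratio `μ * exp (1 - μ) < 1`.
  have h1 : (m.choose j : ℝ) * a ^ j * (1 - a) ^ (m - j) * (μ⁻¹) ^ j ≤ (μ⁻¹ * a + (1 - a)) ^ m := by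
    rw [add_pow]
    have := Finset.single_le_sum (s := Finset.range (m + 1))
      (f := fun i => (μ⁻¹ * a) ^ i * (1 - a) ^ (m - i) * (m.choose i : ℝ))
      (fun i _ => by positivity) (Finset.mem_range.2 (by omega : j < m + 1))
    refine le_trans (le_of_eq ?_) this
    simp only [mul_pow]
    ring
  have h2 : (μ⁻¹ * a + (1 - a)) ^ m ≤ Real.exp ((1 - μ) * (j + 1)) := by
    have hs : μ⁻¹ * a + (1 - a) ≤ Real.exp (-(1 - μ⁻¹) * a) := by
      have := Real.add_one_le_exp (-(1 - μ⁻¹) * a)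
      linarith
    have hs0 : 0 ≤ μ⁻¹ * a + (1 - a) := by positivity
    refine (pow_le_pow_left₀ hs0 hs m).trans ?_
    rw [← Real.exp_nat_mul, Real.exp_le_exp]
    have hi : 0 ≤ (1 - μ⁻¹) * a := mul_nonneg (by have := inv_lt_one_of_one_lt₀ hμ; linarith) ha0
    have h3 : μ * n * ((1 - μ⁻¹) * a) = (μ - 1) * (j + 1) := by
      rw [ha]
      field_simp
    nlinarith [mul_le_mul_of_nonneg_right hm hi]
  have h4 : (m.choose j : ℝ) * a ^ j * (1 - a) ^ (m - j)
      ≤ Real.exp ((1 - μ) * (j + 1)) * μ ^ j := by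
    have := mul_le_mul_of_nonneg_right (h1.trans h2) (pow_nonneg hμ0.le j)
    rwa [mul_assoc, ← mul_pow, inv_mul_cancel₀ hμ0.ne', one_pow, mul_one] at this
  have h5 : Real.exp ((1 - μ) * (j + 1)) * μ ^ j
      = Real.exp (1 - μ) * (μ * Real.exp (1 - μ)) ^ j := by
    rw [mul_pow, ← Real.exp_nat_mul, mul_add, mul_one, Real.exp_add, mul_comm (j : ℝ)]
    ring
  rw [← h5]
  refine le_trans (div_le_self (by positivity) ?_) h4
  linarith [(Nat.cast_nonneg j : (0 : ℝ) ≤ j)]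

lemma mul_exp_one_sub_lt_one {μ : ℝ} (hμ : 1 < μ) : μ * Real.exp (1 - μ) < 1 := by
  have h := Real.add_one_lt_exp (x := μ - 1) (by linarith)
  have h2 : μ < Real.exp (μ - 1) := by linarith
  calc μ * Real.exp (1 - μ) < Real.exp (μ - 1) * Real.exp (1 - μ) :=
        mul_lt_mul_of_pos_right h2 (Real.exp_pos _)
    _ = 1 := by rw [← Real.exp_add]; simp

lemma tendsto_floor_mul_div {lam : ℝ} (hlam : 0 < lam) :
    Tendsto (fun n : ℕ => (⌊lam * (n : ℝ)⌋₊ : ℝ) / n) atTop (𝓝 lam) :=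
  (tendsto_nat_floor_mul_div_atTop hlam.le).comp tendsto_natCast_atTop_atTop

/-- Recovers `n` from the number of drivers, so that a Poisson limit indexed by the number of trials
can be pulled back along `n`. Injectivity needs `lam > 1`: the floor loses less than `1`, hence less
than `1` after division by `lam`. -/
lemma ceil_floor_mul_div {lam : ℝ} (hlam : 1 < lam) (n : ℕ) :
    ⌈(lam⁻¹ : ℝ) * (⌊lam * (n : ℝ)⌋₊ : ℝ)⌉₊ = n := by
  have h0 : 0 < lam := by linarith
  have h1 : (⌊lam * (n : ℝ)⌋₊ : ℝ) ≤ lam * n := Nat.floor_le (by positivity)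
  have h2 : lam * n < (⌊lam * (n : ℝ)⌋₊ : ℝ) + 1 := Nat.lt_floor_add_one _
  rw [inv_mul_eq_div]
  refine le_antisymm (Nat.ceil_le.2 ((div_le_iff₀' h0).2 h1)) ?_
  by_contra! h
  have h3 : ((⌈(⌊lam * (n : ℝ)⌋₊ : ℝ) / lam⌉₊ : ℕ) : ℝ) + 1 ≤ n := by exact_mod_cast h
  have h4 := (div_le_iff₀' h0).1 (Nat.le_ceil ((⌊lam * (n : ℝ)⌋₊ : ℝ) / lam))
  nlinarith

lemma tendsto_failureProb {lam : ℝ} (hlam : 1 < lam) (j : ℕ) :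
    Tendsto (fun n : ℕ => failureProb n ⌊lam * (n : ℝ)⌋₊ j) atTop
      (𝓝 (1 / lam * treeTerm (lam * Real.exp (-lam)) j)) := by
  have h0 : 0 < lam := by linarith
  have hp : Tendsto (fun M : ℕ => (M : ℝ) * (((j : ℝ) + 1) / ⌈lam⁻¹ * (M : ℝ)⌉₊)) atTop
      (𝓝 (((j : ℝ) + 1) * lam)) := by
    have h := ((tendsto_nat_ceil_mul_div_atTop (inv_pos.2 h0).le).comp
      (tendsto_natCast_atTop_atTop (R := ℝ))).inv₀ (inv_pos.2 h0).ne'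
    rw [inv_inv] at h
    refine (h.const_mul ((j : ℝ) + 1)).congr fun M => ?_
    simp only [Function.comp_apply, inv_div]
    ring
  have hM : Tendsto (fun n : ℕ => ⌊lam * (n : ℝ)⌋₊) atTop atTop :=
    tendsto_nat_floor_atTop.comp (tendsto_natCast_atTop_atTop.const_mul_atTop h0)
  have h := ((ProbabilityTheory.tendsto_choose_mul_pow_of_tendsto_mul_atTop j hp).comp hM).div_const
    ((j : ℝ) + 1)
  convert h using 1
  · funext n
    simp only [Function.comp_apply, ceil_floor_mul_div hlam, failureProb]
  · rw [treeTerm, Nat.factorial_succ]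
    push_cast
    rw [mul_pow lam, mul_pow ((j : ℝ) + 1) lam, ← Real.exp_nat_mul]
    push_cast
    rw [show ((j : ℝ) + 1) * -lam = -(((j : ℝ) + 1) * lam) by ring, pow_succ lam]
    have : (j.factorial : ℝ) ≠ 0 := by positivity
    congr 1
    field_simp

lemma summable_treeTerm_and_tendsto_fullProb {lam : ℝ} (hlam : 1 < lam) :
    Summable (treeTerm (lam * Real.exp (-lam))) ∧
      Tendsto (fun n : ℕ => fullProb n ⌊lam * (n : ℝ)⌋₊) atTop
        (𝓝 (1 - 1 / lam * treeFun (lam * Real.exp (-lam)))) := by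
  have h0 : 0 < lam := by linarith
  -- The slack between `μ` and `lam` absorbs the floor: eventually `μ * n ≤ ⌊lam * n⌋₊`.
  obtain ⟨μ, hμ, hμl⟩ := exists_between hlam
  set bound : ℕ → ℝ := fun j => Real.exp (1 - μ) * (μ * Real.exp (1 - μ)) ^ j with hbound
  have hbs : Summable bound :=
    (summable_geometric_of_lt_one (by positivity) (mul_exp_one_sub_lt_one hμ)).mul_left _
  have hm : ∀ᶠ n : ℕ in atTop, μ * n ≤ (⌊lam * (n : ℝ)⌋₊ : ℝ) := by
    filter_upwards [(tendsto_floor_mul_div h0).eventually (eventually_ge_nhds hμl),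
      eventually_gt_atTop 0] with n hn hn0
    exact (le_div_iff₀ (by exact_mod_cast hn0)).1 hn
  -- Extension by zero turns the sum over `j < n` into a series over a fixed index set.
  set f : ℕ → ℕ → ℝ := fun n j => if j < n then failureProb n ⌊lam * (n : ℝ)⌋₊ j else 0 with hf
  have hfb : ∀ᶠ n : ℕ in atTop, ∀ j, ‖f n j‖ ≤ bound j := by
    filter_upwards [hm] with n hn j
    simp only [hf]
    split_ifs with hj
    · rw [Real.norm_of_nonneg (failureProb_nonneg hj)]
      exact failureProb_le hμ hj hn
    · rw [norm_zero]
      positivity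
  have hflim : ∀ j, Tendsto (fun n => f n j) atTop
      (𝓝 (1 / lam * treeTerm (lam * Real.exp (-lam)) j)) := fun j => by
    refine (tendsto_failureProb hlam j).congr' ?_
    filter_upwards [eventually_gt_atTop j] with n hn
    simp [hf, hn]
  -- The dominating geometric series also bounds the pointwise limits.
  have hsum : Summable (treeTerm (lam * Real.exp (-lam))) := by
    refine (summable_mul_left_iff (one_div_pos.2 h0).ne').1 ?_
    refine Summable.of_norm_bounded hbs fun j => ?_
    exact le_of_tendsto (hflim j).norm (hfb.mono fun n hn => hn j)
  refine ⟨hsum, ?_⟩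
  have hT := tendsto_tsum_of_dominated_convergence hbs hflim hfb
  rw [tsum_mul_left] at hT
  refine (hT.const_sub 1).congr' ?_
  filter_upwards [hm, eventually_gt_atTop 0] with n hn hn0
  have hnm : n ≤ ⌊lam * (n : ℝ)⌋₊ := Nat.le_floor (by nlinarith [(Nat.cast_nonneg n : (0 : ℝ) ≤ n)])
  rw [fullProb_eq_one_sub_sum hn0 hnm, tsum_eq_sum (s := Finset.range n)]
  · congr 1
    exact Finset.sum_congr rfl fun j hj => by simp [hf, Finset.mem_range.1 hj]
  · intro j hj
    have : ¬ j < n := fun h => hj (Finset.mem_range.2 h)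
    simp [hf, this]

/-- For `n > 0` the probability equals `(1 + 1 / n) ^ n / (n + 1)`, whose numerator tends to `e`. -/
lemma tendsto_fullProb_self : Tendsto (fun n : ℕ => fullProb n n) atTop (𝓝 0) := by
  have h1 : Tendsto (fun n : ℕ => (1 + 1 / (n : ℝ)) ^ n) atTop (𝓝 (Real.exp 1)) :=
    Real.tendsto_one_add_div_pow_exp 1
  have h2 := h1.mul tendsto_one_div_add_atTop_nhds_zero_nat
  rw [mul_zero] at h2
  refine h2.congr' ?_
  filter_upwards [eventually_gt_atTop 0] with n hn
  have hn' : (n : ℝ) ≠ 0 := by positivity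
  rw [fullProb_eq_fullCount_div, fullCount_self, show 1 + 1 / (n : ℝ) = (n + 1) / n by field_simp,
    div_pow]
  ring

lemma tendsto_fullProb_of_le_one {lam : ℝ} (hlam : 0 < lam) (h : lam ≤ 1) :
    Tendsto (fun n : ℕ => fullProb n ⌊lam * (n : ℝ)⌋₊) atTop (𝓝 0) := by
  rcases h.lt_or_eq with h | rfl
  · refine tendsto_const_nhds.congr' ?_
    filter_upwards [eventually_gt_atTop 0] with n hn
    have hn' : (0 : ℝ) < n := by exact_mod_cast hn
    rw [fullProb_eq_fullCount_div, fullCount_eq_zero_of_lt, Nat.cast_zero, zero_div]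
    exact (Nat.floor_lt (by positivity)).2 (by nlinarith)
  · simpa using tendsto_fullProb_self

end CarPark


theorem mainTheorem4 (lam : ℝ) (hlam : 0 < lam) :
    (∀ n : ℕ, CarPark.fullProb n ⌊lam * (n : ℝ)⌋₊ =
      (CarPark.cp n ⌊lam * (n : ℝ)⌋₊ ((⌊lam * (n : ℝ)⌋₊ : ℤ) - (n : ℤ)) : ℝ) /
        (n : ℝ) ^ ⌊lam * (n : ℝ)⌋₊) ∧
    (lam ≤ 1 →
      Tendsto (fun n : ℕ => CarPark.fullProb n ⌊lam * (n : ℝ)⌋₊) atTop (𝓝 0)) ∧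
    (1 < lam →
      Summable (CarPark.treeTerm (lam * Real.exp (-lam))) ∧
      Tendsto (fun n : ℕ => CarPark.fullProb n ⌊lam * (n : ℝ)⌋₊) atTop
        (𝓝 (1 - 1 / lam * CarPark.treeFun (lam * Real.exp (-lam))))) :=
  ⟨fun n => CarPark.fullProb_eq_cp_div n _, CarPark.tendsto_fullProb_of_le_one hlam,
    CarPark.summable_treeTerm_and_tendsto_fullProb⟩
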